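/- Let $p$ be a prime and let $s, m, n, d$ be integers with $s \ge 1$ and $2 \le d \le m \le n$. For a matrix $A \in \mathbb{Z}_{p^s}^{m\times n}$, where $\mathbb{Z}_{p^s} = \mathbb{Z}/p^s\mathbb{Z}$, let the inner rank $\rho(A)$ be the least positive integer $r$ such that $A = BC$ for some $B \in \mathbb{Z}_{p^s}^{m\times r}$ and $C \in \mathbb{Z}_{p^s}^{r\times n}$ if $A \neq 0$, and let $\rho(0) = 0$. Let $\Gamma_d(\mathbb{Z}_{p^s}^{m\times n})$ be the simple graph with vertex set $\mathbb{Z}_{p^s}^{m\times n}$ in which two distinct vertices $A$ and $B$ are adjacent if and only if $\rho(A-B) < d$. A graph is called a core if every endomorphism of it is an automorphism; a subgraph $H$ of a graph $G$ is called a core of $G$ if $H$ is a core and there is a graph homomorphism from $G$ to $H$. A maximum clique of $G$ is a complete subgraph of $G$ with the largest possible number of vertices. Then $\Gamma_d(\mathbb{Z}_{p^s}^{m\times n})$ has a core, every core of $\Gamma_d(\mathbb{Z}_{p^s}^{m\times n})$ is a maximum clique of $\Gamma_d(\mathbb{Z}_{p^s}^{m\times n})$, and $\Gamma_d(\mathbb{Z}_{p^s}^{m\times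 n})$ is not itself a core. -/

import Mathlib

/-- The inner rank of `A`: the least `r` such that `A = B * C` with `B` of size `m × r` and `C` of
size `r × n`. The value `r = 0` is possible exactly for `A = 0` (an empty product), so this is `0`
for `A = 0` and the least positive such `r` for `A ≠ 0`; the set is nonempty as `A = 1 * A`. -/
noncomputable def innerRank {R : Type*} [CommRing R] {m n : ℕ} (A : Matrix (Fin m) (Fin n) R) : ℕ :=
  sInf {r : ℕ | ∃ (B : Matrix (Fin m) (Fin r) R) (C : Matrix (Fin r) (Fin n) R), A = B * C}

theorem innerRank_neg {R : Type*} [CommRing R] {m n : ℕ} (A : Matrix (Fin m) (Fin n) R) :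
    innerRank (-A) = innerRank A := by
  unfold innerRank
  congr 1
  ext r
  constructor
  · rintro ⟨B, C, h⟩
    exact ⟨-B, C, by rw [Matrix.neg_mul, ← h, neg_neg]⟩
  · rintro ⟨B, C, h⟩
    exact ⟨-B, C, by rw [Matrix.neg_mul, ← h]⟩

/-- The generalized bilinear forms graph `Γ_d(R^{m × n})`: the vertices are the `m × n` matrices
over `R`, and two distinct matrices are adjacent when their difference has inner rank `< d`. -/
def bilinearFormsGraph (R : Type*) [CommRing R] (m n d : ℕ) :
    SimpleGraph (Matrix (Fin m) (Fin n) R) where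
  Adj A B := A ≠ B ∧ innerRank (A - B) < d
  symm := ⟨fun A B h => ⟨h.1.symm, by rw [← neg_sub, innerRank_neg]; exact h.2⟩⟩
  loopless := ⟨fun _ h => h.1 rfl⟩

/-- A graph is a core if every endomorphism of it is an automorphism. -/
def IsCoreGraph {V : Type*} (G : SimpleGraph V) : Prop :=
  ∀ f : G →g G, ∃ e : G ≃g G, ∀ v, e v = f v

/-- A subgraph `H` of `G` is a core of `G` if `H` is a core and there is a homomorphism from `G`
to `H`. -/
def IsCoreOf {V : Type*} (G : SimpleGraph V) (H : G.Subgraph) : Prop :=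
  IsCoreGraph H.coe ∧ Nonempty (G →g H.coe)

/-! The graph has a clique and a proper colouring of the same size `p ^ (s * n * (d - 1))`, so it
retracts onto a clique. The clique consists of the matrices supported on the first `d - 1` rows. The
colouring is an additive syndrome map whose kernel contains no nonzero matrix of inner rank below
`d`: a Gabidulin code lifted from `𝔽_p` to `ℤ / p ^ s`. Over `𝔽_p` the Moore determinant gives the
distance bound. Over `ℤ / p ^ s`, a bad matrix is lifted to `ℤ` and divided by its power of `p`, and
its reduction mod `p` contradicts the field case. -/

theorem SimpleGraph.injective_hom_of_complete {V W : Type*} {G : SimpleGraph V} {G' : SimpleGraph W}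
    (hG : ∀ u v, u ≠ v → G.Adj u v) (f : G →g G') : Function.Injective f := by
  intro u v huv
  by_contra hne
  exact (f.map_rel (hG u v hne)).ne huv

theorem isCoreGraph_of_complete {V : Type*} [Finite V] {G : SimpleGraph V}
    (hG : ∀ u v, u ≠ v → G.Adj u v) : IsCoreGraph G := by
  intro f
  have hf := SimpleGraph.injective_hom_of_complete hG f
  refine ⟨⟨Equiv.ofBijective f (Finite.injective_iff_bijective.mp hf), ?_⟩, fun v => rfl⟩
  intro a b
  constructor
  · intro h
    exact hG a b fun hab => h.ne (by rw [hab])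
  · intro h
    exact f.map_rel h

/-- If a finite graph has a clique and a proper coloring of the same size, its cores are precisely
its maximum cliques. -/
theorem cores_of_clique_of_coloring {V α : Type*} [Finite V] [Finite α] (G : SimpleGraph V)
    (e : (⊤ : SimpleGraph α) →g G) (c : G →g (⊤ : SimpleGraph α)) :
    (∃ H : G.Subgraph, IsCoreOf G H) ∧
    (∀ H : G.Subgraph, IsCoreOf G H → ∃ M : Finset V, G.IsMaximumClique M ∧
      H = (⊤ : G.Subgraph).induce (M : Set V)) := by
  classical
  have := Fintype.ofFinite V
  have := Fintype.ofFinite α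
  have he : Function.Injective e :=
    SimpleGraph.injective_hom_of_complete (fun _ _ h => (SimpleGraph.top_adj _ _).2 h) e
  constructor
  · refine ⟨(⊤ : G.Subgraph).induce (Set.range e), isCoreGraph_of_complete ?_,
      ⟨⟨fun v => ⟨e (c v), Set.mem_range_self _⟩, ?_⟩⟩⟩
    · rintro ⟨_, a, rfl⟩ ⟨_, b, rfl⟩ h
      have hab : a ≠ b := by rintro rfl; exact h rfl
      exact ⟨⟨a, rfl⟩, ⟨b, rfl⟩, e.map_rel ((SimpleGraph.top_adj _ _).2 hab)⟩
    · intro u v huv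
      exact ⟨⟨_, rfl⟩, ⟨_, rfl⟩, e.map_rel (c.map_rel huv)⟩
  · rintro H ⟨hH, ⟨g⟩⟩
    -- This endomorphism of `H` passes through the colour set. Being an automorphism, it is onto, so
    -- the images of the colours exhaust `H`.
    obtain ⟨φ, hφ⟩ := hH ((g.comp e).comp (c.comp H.hom))
    have hadj : ∀ a b : α, a ≠ b → H.Adj (g (e a)) (g (e b)) := fun a b hab =>
      g.map_rel (e.map_rel ((SimpleGraph.top_adj _ _).2 hab))
    have hsurj : ∀ v ∈ H.verts, ∃ a : α, v = g (e a) := by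
      intro v hv
      refine ⟨c (φ.symm ⟨v, hv⟩), ?_⟩
      have h := hφ (φ.symm ⟨v, hv⟩)
      rw [RelIso.apply_symm_apply] at h
      exact congrArg Subtype.val h
    have hcomplete : ∀ u ∈ H.verts, ∀ v ∈ H.verts, u ≠ v → H.Adj u v := by
      intro u hu v hv huv
      obtain ⟨a, rfl⟩ := hsurj u hu
      obtain ⟨b, rfl⟩ := hsurj v hv
      exact hadj a b fun hab => huv (by rw [hab])
    have hM : ((H.verts.toFinset : Finset V) : Set V) = H.verts := Set.coe_toFinset _
    refine ⟨H.verts.toFinset, ⟨?_, ?_⟩, ?_⟩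
    · rw [hM]
      intro u hu v hv huv
      exact (hcomplete u hu v hv huv).adj_sub
    · intro t ht
      have h1 : t.card ≤ Fintype.card α := by
        refine Finset.card_le_card_of_injOn c (fun _ _ => Finset.mem_univ _) ?_
        intro u hu v hv huv
        by_contra hne
        exact (c.map_rel (ht hu hv hne)).ne huv
      refine h1.trans ?_
      rw [← Finset.card_univ]
      refine Finset.card_le_card_of_injOn (fun a => (g (e a) : V))
        (fun a _ => by simp) ?_
      intro a _ b _ hab
      by_contra hne
      exact (hadj a b hne).ne hab
    · rw [hM]
      ext u v
      · rfl
      · exact ⟨fun h => ⟨h.fst_mem, h.snd_mem, h.adj_sub⟩,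
          fun h => hcomplete u h.1 v h.2.1 h.2.2.ne⟩

theorem not_isCoreGraph_of_hom {V α : Type*} [Finite V] [Finite α] (G : SimpleGraph V)
    (e : (⊤ : SimpleGraph α) →g G) (c : G →g (⊤ : SimpleGraph α)) (hcard : Nat.card α < Nat.card V) :
    ¬ IsCoreGraph G := by
  intro h
  obtain ⟨φ, hφ⟩ := h (e.comp c)
  refine hcard.not_ge (Nat.card_le_card_of_injective c fun u v huv => φ.injective ?_)
  rw [hφ, hφ]
  exact congrArg e huv

/-- Nonsingularity of the Moore matrix of a linearly independent family. -/
theorem eq_zero_of_moore {p : ℕ} [Fact p.Prime] {K : Type*} [Field K] [Algebra (ZMod p) K] {r : ℕ}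
    {h : Fin r → K} (hli : LinearIndependent (ZMod p) h) {y : Fin r → K}
    (hy : ∀ j : Fin r, ∑ l, y l * h l ^ p ^ (j : ℕ) = 0) : y = 0 := by
  classical
  have : CharP K p := charP_of_injective_algebraMap (algebraMap (ZMod p) K).injective p
  by_contra hy0
  have hdet : (Matrix.of fun j l : Fin r => h l ^ p ^ (j : ℕ)).det = 0 := by
    rw [← Matrix.exists_mulVec_eq_zero_iff]
    refine ⟨y, hy0, ?_⟩
    ext j
    rw [Pi.zero_apply, ← hy j]
    simp only [Matrix.mulVec, dotProduct, Matrix.of_apply, mul_comm]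
  -- A left kernel vector is the coefficient vector of a `p`-polynomial of degree below `p ^ r` that
  -- vanishes on the `p ^ r` elements of the `𝔽_p`-span of `h`.
  obtain ⟨c, hc0, hc⟩ := Matrix.exists_vecMul_eq_zero_iff.mpr hdet
  have hcl : ∀ l, ∑ j, c j * h l ^ p ^ (j : ℕ) = 0 := fun l => congrFun hc l
  set P : Polynomial K := ∑ j : Fin r, Polynomial.C (c j) * Polynomial.X ^ p ^ (j : ℕ) with hP
  have hp1 : 1 < p := (Fact.out : p.Prime).one_lt
  have hr : 0 < r := by
    by_contra h0
    obtain rfl : r = 0 := by omega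
    exact hc0 (Subsingleton.elim _ _)
  have hdeg : P.natDegree < p ^ r := by
    refine lt_of_le_of_lt (Polynomial.natDegree_sum_le_of_forall_le (n := p ^ (r - 1)) _ _ ?_)
      (Nat.pow_lt_pow_right hp1 (by omega))
    intro j _
    exact (Polynomial.natDegree_C_mul_X_pow_le _ _).trans
      (Nat.pow_le_pow_right hp1.le (by omega))
  have hroot : ∀ a : Fin r → ZMod p, P.eval (∑ l, a l • h l) = 0 := by
    intro a
    have key : ∀ j : ℕ, (∑ l, a l • h l) ^ p ^ j = ∑ l, a l • h l ^ p ^ j := by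
      intro j
      rw [sum_pow_char_pow]
      refine Finset.sum_congr rfl fun l _ => ?_
      rw [smul_pow, ZMod.pow_card_pow]
    simp only [hP, Polynomial.eval_finsetSum, Polynomial.eval_mul, Polynomial.eval_C,
      Polynomial.eval_pow, Polynomial.eval_X, key, Finset.mul_sum, mul_smul_comm]
    rw [Finset.sum_comm]
    simp only [← Finset.smul_sum, hcl, smul_zero, Finset.sum_const_zero]
  have hP0 : P = 0 := by
    refine Polynomial.eq_zero_of_natDegree_lt_card_of_eval_eq_zero P
      (linearIndependent_iff_injective_fintypeLinearCombination.mp hli) ?_ ?_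
    · intro a
      rw [Fintype.linearCombination_apply]
      exact hroot a
    · simpa [ZMod.card] using hdeg
  refine hc0 (funext fun j => ?_)
  have := congrArg (fun Q => Polynomial.coeff Q (p ^ (j : ℕ))) hP0
  simp only [hP, Polynomial.finsetSum_coeff, Polynomial.coeff_C_mul, Polynomial.coeff_X_pow,
    Polynomial.coeff_zero, mul_ite, mul_one, mul_zero] at this
  rw [Finset.sum_eq_single j] at this
  · simpa using this
  · intro b _ hb
    rw [if_neg]
    intro hh
    exact hb (Fin.ext (Nat.pow_right_injective hp1 hh).symm)
  · simp

/-- A matrix over a principal ideal domain factors through a matrix with linearly independent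
columns. -/
theorem Matrix.exists_factorization_rank {R : Type*} [CommRing R] [IsDomain R]
    [IsPrincipalIdealRing R] {m n : ℕ} (M : Matrix (Fin m) (Fin n) R) :
    ∃ (B : Matrix (Fin m) (Fin M.rank) R) (C : Matrix (Fin M.rank) (Fin n) R),
      LinearIndependent R B.col ∧ M = B * C := by
  classical
  let b := Module.finBasis R (LinearMap.range M.mulVecLin)
  let v : Fin n → LinearMap.range M.mulVecLin := fun k =>
    ⟨M.mulVecLin (Pi.single k 1), LinearMap.mem_range_self _ _⟩
  refine ⟨Matrix.of fun i l => (b l : Fin m → R) i, Matrix.of fun l k => b.repr (v k) l, ?_, ?_⟩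
  · exact b.linearIndependent.map' (Submodule.subtype _) (Submodule.ker_subtype _)
  · ext i k
    have h := congrFun (congrArg Subtype.val (b.sum_repr (v k))) i
    have h3 : M i k = (v k : Fin m → R) i := by simp [v]
    rw [h3, ← h]
    simp only [Submodule.coe_sum, SetLike.val_smul, Finset.sum_apply, Pi.smul_apply, smul_eq_mul,
      Matrix.mul_apply, Matrix.of_apply, mul_comm]
    rfl

/-- An integer matrix has rank at most `r` if some nonzero multiple factors through `ℤ ^ r`. -/
theorem Matrix.rank_le_of_smul_eq_mul {m n r : ℕ} {a : ℤ} (ha : a ≠ 0)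
    {M : Matrix (Fin m) (Fin n) ℤ} {B : Matrix (Fin m) (Fin r) ℤ} {C : Matrix (Fin r) (Fin n) ℤ}
    (h : a • M = B * C) : M.rank ≤ r := by
  have h1 : ∀ w : LinearMap.range M.mulVecLin,
      a • (w : Fin m → ℤ) ∈ LinearMap.range B.mulVecLin := by
    rintro ⟨_, v, rfl⟩
    refine ⟨C.mulVec v, ?_⟩
    simp only [Matrix.mulVecLin_apply, Matrix.mulVec_mulVec, ← h, Matrix.smul_mulVec]
  let f : LinearMap.range M.mulVecLin →ₗ[ℤ] LinearMap.range B.mulVecLin :=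
    (a • Submodule.subtype _).codRestrict _ h1
  have hf : Function.Injective f := by
    intro u v huv
    have := congrArg Subtype.val huv
    exact Subtype.ext (smul_right_injective _ ha this)
  refine (LinearMap.finrank_le_finrank_of_injective hf).trans ?_
  simpa using LinearMap.finrank_range_le B.mulVecLin

/-- The Gabidulin parity checks detect every nonzero matrix of rank less than `d`. -/
theorem eq_zero_of_parity_checks {p : ℕ} [Fact p.Prime] {K : Type*} [Field K] [Algebra (ZMod p) K]
    {m n d t : ℕ} {ω : Fin n → K} (hω : LinearIndependent (ZMod p) ω) {g : Fin m → K}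
    (hg : LinearIndependent (ZMod p) g) (ht : t ≤ d) (B : Matrix (Fin m) (Fin t) (ZMod p))
    (hB : LinearIndependent (ZMod p) B.col) (C : Matrix (Fin t) (Fin n) (ZMod p))
    (h : ∀ j : Fin d, ∑ i, ∑ k, (B * C) i k • (ω k * g i ^ p ^ (j : ℕ)) = 0) : C = 0 := by
  classical
  have : CharP K p := charP_of_injective_algebraMap (algebraMap (ZMod p) K).injective p
  have hli : LinearIndependent (ZMod p) fun l : Fin t => ∑ i, B i l • g i := by
    rw [Fintype.linearIndependent_iff]
    intro a ha
    refine Fintype.linearIndependent_iff.mp hB a ?_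
    simp only [Finset.smul_sum, smul_smul] at ha
    rw [Finset.sum_comm] at ha
    simp only [← Finset.sum_smul] at ha
    ext i
    simpa [Matrix.col] using Fintype.linearIndependent_iff.mp hg _ ha i
  -- Substituting the factorization turns the first `t` checks into a Moore system with nodes `gB`
  -- and unknowns `Cω`.
  have hy := eq_zero_of_moore hli (y := fun l => ∑ k, C l k • ω k) fun j => by
    have key : (fun l : Fin t => (∑ i, B i l • g i) ^ p ^ (j : ℕ))
        = fun l => ∑ i, B i l • g i ^ p ^ (j : ℕ) := by
      funext l
      rw [sum_pow_char_pow]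
      refine Finset.sum_congr rfl fun i _ => ?_
      rw [smul_pow, ZMod.pow_card_pow]
    simp only [fun l => congrFun key l]
    rw [← h ⟨j, j.2.trans_le ht⟩]
    calc ∑ l, (∑ k, C l k • ω k) * ∑ i, B i l • g i ^ p ^ (j : ℕ)
        = ∑ l, ∑ i, ∑ k, (B i l * C l k) • (ω k * g i ^ p ^ (j : ℕ)) := by
          refine Finset.sum_congr rfl fun l _ => ?_
          rw [Finset.sum_mul_sum, Finset.sum_comm]
          simp only [smul_mul_smul_comm, mul_comm (B _ l)]
      _ = ∑ i, ∑ k, (B * C) i k • (ω k * g i ^ p ^ (j : ℕ)) := by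
          simp only [Matrix.mul_apply, Finset.sum_smul]
          rw [Finset.sum_comm]
          exact Finset.sum_congr rfl fun i _ => Finset.sum_comm
  ext l k
  exact Fintype.linearIndependent_iff.mp hω _ (congrFun hy l) k

theorem Matrix.exists_eq_pow_smul_primitive {p : ℤ} {m n s : ℕ} (T : Matrix (Fin m) (Fin n) ℤ)
    (hT : ¬ ∀ i k, p ^ s ∣ T i k) :
    ∃ (e : ℕ) (M : Matrix (Fin m) (Fin n) ℤ), e < s ∧ T = p ^ e • M ∧ ¬ ∀ i k, p ∣ M i k := by
  induction s generalizing T with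
  | zero => exact absurd (fun i k => by simp) hT
  | succ s ih =>
    by_cases hp : ∀ i k, p ∣ T i k
    · choose T' hT' using hp
      obtain ⟨e, M, he, hM, hprim⟩ := ih (Matrix.of T') fun h => hT fun i k => by
        rw [hT' i k, pow_succ']
        exact mul_dvd_mul_left _ (h i k)
      refine ⟨e + 1, M, by omega, ?_, hprim⟩
      ext i k
      have := congrFun (congrFun hM i) k
      simp only [Matrix.of_apply, Matrix.smul_apply, smul_eq_mul] at this ⊢
      rw [hT', this]
      ring
    · exact ⟨0, T, by omega, by simp, hp⟩

theorem exists_factorization_of_innerRank_lt {R : Type*} [CommRing R] {m n d : ℕ}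
    {A : Matrix (Fin m) (Fin n) R} (h : innerRank A < d) :
    ∃ (r : ℕ) (B : Matrix (Fin m) (Fin r) R) (C : Matrix (Fin r) (Fin n) R), r < d ∧ A = B * C := by
  obtain ⟨B, C, hBC⟩ := Nat.sInf_mem (s := {r : ℕ | ∃ (B : Matrix (Fin m) (Fin r) R)
    (C : Matrix (Fin r) (Fin n) R), A = B * C}) ⟨m, 1, A, by simp⟩
  exact ⟨_, B, C, h, hBC⟩

/-- Parity checks over `ℤ / p ^ s` detecting every nonzero matrix of inner rank at most `d`. -/
theorem exists_parity_checks (p : ℕ) [Fact p.Prime] {s m n : ℕ} (d : ℕ) (hn : n ≠ 0)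
    (hmn : m ≤ n) :
    ∃ f : Matrix (Fin m) (Fin n) (ZMod (p ^ s)) →+ (Fin d → Fin n → ZMod (p ^ s)),
      ∀ A, innerRank A < d + 1 → f A = 0 → A = 0 := by
  classical
  have hp : p.Prime := Fact.out
  let K := GaloisField p n
  let ω : Module.Basis (Fin n) (ZMod p) K :=
    Module.finBasisOfFinrankEq _ _ (GaloisField.finrank p hn)
  let g : Fin m → K := fun i => ω (Fin.castLE hmn i)
  have hg : LinearIndependent (ZMod p) g :=
    ω.linearIndependent.comp _ (Fin.castLE_injective hmn)
  -- Integer lifts of the `𝔽_p`-coordinates of the Gabidulin coefficients; each check over `K`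
  -- becomes `n` scalar checks.
  let c : Fin d → Fin n → Fin m → Fin n → ℤ := fun j l i k =>
    ((ω.repr (ω k * g i ^ p ^ (j : ℕ)) l).val : ℤ)
  refine ⟨{ toFun := fun A j l => ∑ i, ∑ k, A i k * (c j l i k : ZMod (p ^ s))
            map_zero' := by ext; simp
            map_add' := fun A A' => by
              ext; simp [add_mul, Finset.sum_add_distrib] }, fun A hA hf => ?_⟩
  by_contra hA0
  obtain ⟨r, B, C, hr, hBC⟩ := exists_factorization_of_innerRank_lt hA
  obtain ⟨B', rfl⟩ : ∃ B' : Matrix (Fin m) (Fin r) ℤ, B'.map (Int.castRingHom _) = B :=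
    ⟨B.map fun x => (ZMod.intCast_surjective x).choose,
      by ext i j; exact (ZMod.intCast_surjective (B i j)).choose_spec⟩
  obtain ⟨C', rfl⟩ : ∃ C' : Matrix (Fin r) (Fin n) ℤ, C'.map (Int.castRingHom _) = C :=
    ⟨C.map fun x => (ZMod.intCast_surjective x).choose,
      by ext i j; exact (ZMod.intCast_surjective (C i j)).choose_spec⟩
  rw [← Matrix.map_mul] at hBC
  subst hBC
  obtain ⟨e, M, he, hM, hprim⟩ := Matrix.exists_eq_pow_smul_primitive (p := (p : ℤ)) (s := s)
    (B' * C') fun h => hA0 <| by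
      ext i k
      have := (ZMod.intCast_zmod_eq_zero_iff_dvd ((B' * C') i k) (p ^ s)).mpr
        (by exact_mod_cast h i k)
      simpa using this
  have hpe : (p : ℤ) ^ e ≠ 0 := pow_ne_zero _ (by exact_mod_cast hp.ne_zero)
  have hcheck : ∀ j l, (p : ℤ) ∣ ∑ i, ∑ k, M i k * c j l i k := by
    intro j l
    have h1 := congrFun (congrFun hf j) l
    have h2 : ((∑ i, ∑ k, (B' * C') i k * c j l i k : ℤ) : ZMod (p ^ s)) = 0 := by
      simpa using h1
    rw [ZMod.intCast_zmod_eq_zero_iff_dvd, hM] at h2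
    have h3 : ∑ i, ∑ k, ((p : ℤ) ^ e • M) i k * c j l i k
        = (p : ℤ) ^ e * ∑ i, ∑ k, M i k * c j l i k := by
      simp only [Matrix.smul_apply, smul_eq_mul, Finset.mul_sum, mul_assoc]
    rw [h3] at h2
    -- Since `e < s`, a factor `p` survives the division by `p ^ e`.
    have h4 : (p : ℤ) ^ e * p ∣ (p : ℤ) ^ e * ∑ i, ∑ k, M i k * c j l i k := by
      refine dvd_trans ?_ h2
      rw [← pow_succ]
      push_cast
      exact pow_dvd_pow _ he
    exact (mul_dvd_mul_iff_left hpe).mp h4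
  -- The factors `B'` and `C'` need not be divisible by powers of `p`, so the bound passes to `M`
  -- through its rank. As `ℤ` is a PID, `M` factors at its rank, and reducing that factorization
  -- shows that the rank does not grow mod `p`.
  have ht := Matrix.rank_le_of_smul_eq_mul hpe hM.symm
  obtain ⟨B₁, C₁, -, hMBC⟩ := M.exists_factorization_rank
  obtain ⟨B₂, C₂, hli, hBC₂⟩ := (M.map (Int.castRingHom (ZMod p))).exists_factorization_rank
  have hu : (M.map (Int.castRingHom (ZMod p))).rank ≤ M.rank := by
    conv_lhs => rw [hMBC, Matrix.map_mul]
    exact (Matrix.rank_mul_le_left _ _).trans (Matrix.rank_le_width _)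
  have hC := eq_zero_of_parity_checks (d := d) ω.linearIndependent hg (by omega)
      B₂ hli C₂ fun j => by
    rw [← hBC₂]
    refine ω.repr.injective ?_
    ext l
    have h1 := (ZMod.intCast_zmod_eq_zero_iff_dvd _ p).mpr (hcheck j l)
    simpa [c] using h1
  rw [hC, Matrix.mul_zero] at hBC₂
  refine hprim fun i k => (ZMod.intCast_zmod_eq_zero_iff_dvd _ p).mp ?_
  exact congrFun (congrFun hBC₂ i) k

theorem corollary4p6 (p : ℕ) [Fact p.Prime] (s m n d : ℕ) (hs : 1 ≤ s)
    (hd : 2 ≤ d) (hdm : d ≤ m) (hmn : m ≤ n) :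
    (∃ H : (bilinearFormsGraph (ZMod (p ^ s)) m n d).Subgraph,
      IsCoreOf (bilinearFormsGraph (ZMod (p ^ s)) m n d) H) ∧
    (∀ H : (bilinearFormsGraph (ZMod (p ^ s)) m n d).Subgraph,
      IsCoreOf (bilinearFormsGraph (ZMod (p ^ s)) m n d) H →
        ∃ M : Finset (Matrix (Fin m) (Fin n) (ZMod (p ^ s))),
          (bilinearFormsGraph (ZMod (p ^ s)) m n d).IsMaximumClique M ∧
          H = (⊤ : (bilinearFormsGraph (ZMod (p ^ s)) m n d).Subgraph).induce (M : Set _)) ∧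
    ¬ IsCoreGraph (bilinearFormsGraph (ZMod (p ^ s)) m n d) := by
  -- From here `d` is one less than in the statement: adjacency means inner rank at most `d`.
  obtain ⟨d, rfl⟩ : ∃ d', d = d' + 1 := ⟨d - 1, by omega⟩
  obtain ⟨f, hf⟩ := exists_parity_checks p (m := m) d (by omega) hmn
  let c : bilinearFormsGraph (ZMod (p ^ s)) m n (d + 1) →g
      (⊤ : SimpleGraph (Fin d → Fin n → ZMod (p ^ s))) :=
    ⟨f, fun {A A'} h => (SimpleGraph.top_adj _ _).2 fun hff =>
      h.1 (sub_eq_zero.mp (hf _ h.2 (by rw [map_sub, hff, sub_self])))⟩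
  -- `P * X` is `X` padded with zero rows, so differences of such matrices factor through width `d`.
  let P : Matrix (Fin m) (Fin d) (ZMod (p ^ s)) :=
    Matrix.of fun i j => if i = Fin.castLE (by omega) j then 1 else 0
  have hP : ∀ (X : Matrix (Fin d) (Fin n) (ZMod (p ^ s))) j k,
      (P * X) (Fin.castLE (by omega) j) k = X j k := by
    intro X j k
    simp [P, Matrix.mul_apply, Fin.castLE_inj]
  let e : (⊤ : SimpleGraph (Fin d → Fin n → ZMod (p ^ s))) →g
      bilinearFormsGraph (ZMod (p ^ s)) m n (d + 1) :=
    ⟨fun X => P * Matrix.of X, fun {X Y} h => ⟨fun hXY => (SimpleGraph.top_adj _ _).1 h (by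
      ext j k
      exact (hP (Matrix.of X) j k).symm.trans
        ((congrFun (congrFun hXY _) k).trans (hP (Matrix.of Y) j k))),
      Nat.lt_succ_of_le (Nat.sInf_le ⟨P, Matrix.of X - Matrix.of Y, by rw [Matrix.mul_sub]⟩)⟩⟩
  obtain ⟨h1, h2⟩ := cores_of_clique_of_coloring _ e c
  refine ⟨h1, h2, not_isCoreGraph_of_hom _ e c ?_⟩
  have hq : 1 < p ^ s := Nat.one_lt_pow (by omega) (Fact.out : p.Prime).one_lt
  have hcard : ∀ l : ℕ, Nat.card (Fin l → Fin n → ZMod (p ^ s)) = ((p ^ s) ^ n) ^ l := fun l => by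
    simp only [Nat.card_fun, Nat.card_zmod, Nat.card_fin]
  refine (hcard d).trans_lt (lt_of_lt_of_eq ?_ (hcard m).symm)
  exact Nat.pow_lt_pow_right (Nat.one_lt_pow (by omega) hq) (by omega)
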